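/- Let $G$ be a linear algebraic group over $\mathbb{C}$, that is, a Zariski closed subgroup of some $\mathrm{GL}_n(\mathbb{C})$. Let $$C(G)=\{(a,b)\in G\times G : ab=ba\},$$ a Zariski closed subset of $G\times G$, and define the commuting probability of $G$ by $$p(G)=\frac{\dim C(G)}{\dim (G\times G)}=\frac{\dim C(G)}{2\dim G}$$ if $\dim G>0$, and $p(G)=1$ if $\dim G=0$. **Proposition.** For every rational number $x\in(\tfrac12,1]$ there exists a connected nilpotent linear algebraic group $G$ over $\mathbb{C}$ with $p(G)=x$. -/

import Mathlib

open MvPolynomial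
open scoped Topology

noncomputable section

/-- The Zariski topology on the affine space `ℂ^σ`: a set is closed if and only if it is the common
zero set of an ideal of polynomials. -/
@[reducible] def zariskiTopology (σ : Type) : TopologicalSpace (σ → ℂ) :=
  TopologicalSpace.ofClosed {S | ∃ I : Ideal (MvPolynomial σ ℂ), S = zeroLocus ℂ I}
    ⟨⊤, by simp⟩
    (by
      intro A hA
      refine ⟨⨆ S ∈ A, vanishingIdeal ℂ S, ?_⟩
      ext x
      constructor
      · intro hx
        have h : (⨆ S ∈ A, vanishingIdeal ℂ S) ≤ vanishingIdeal ℂ {x} := by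
          refine iSup₂_le fun S hS => vanishingIdeal_anti_mono ?_
          exact Set.singleton_subset_iff.2 (hx S hS)
        exact fun p hp => h hp x rfl
      · intro hx S hS
        obtain ⟨I, rfl⟩ := hA hS
        intro p hp
        have h : vanishingIdeal ℂ (zeroLocus ℂ I) ≤ ⨆ S ∈ A, vanishingIdeal ℂ S :=
          le_iSup₂_of_le (zeroLocus ℂ I) hS le_rfl
        exact hx p (h (le_vanishingIdeal_zeroLocus I hp)))
    (by
      rintro _ ⟨I, rfl⟩ _ ⟨J, rfl⟩
      refine ⟨I * J, ?_⟩
      ext x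
      constructor
      · rintro (hx | hx) p hp
        · exact hx p (Ideal.mul_le_left hp)
        · exact hx p (Ideal.mul_le_right hp)
      · intro hx
        by_contra hcon
        simp only [Set.mem_union, mem_zeroLocus_iff, not_or, not_forall] at hcon
        obtain ⟨⟨p, hp, hpx⟩, ⟨q, hq, hqx⟩⟩ := hcon
        have := hx (p * q) (Ideal.mul_mem_mul hp hq)
        rw [map_mul] at this
        exact (mul_ne_zero hpx hqx) this)

/-- The closed sets of `zariskiTopology` are the zero loci. -/
theorem isClosed_zariskiTopology_iff {σ : Type} (S : Set (σ → ℂ)) :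
    IsClosed[zariskiTopology σ] S ↔ ∃ I : Ideal (MvPolynomial σ ℂ), S = zeroLocus ℂ I := by
  rw [← @isOpen_compl_iff _ _ (zariskiTopology σ)]
  change Sᶜᶜ ∈ {S | ∃ I : Ideal (MvPolynomial σ ℂ), S = zeroLocus ℂ I} ↔ _
  rw [compl_compl]
  rfl

/-- The dimension of the Zariski closure of a nonempty set `S ⊆ ℂ^σ`, that is, the Krull dimension
of the coordinate ring `ℂ[x_i : i ∈ σ] / I(S)`. -/
def zariskiDim {σ : Type} (S : Set (σ → ℂ)) : ℕ :=
  ((ringKrullDim (MvPolynomial σ ℂ ⧸ vanishingIdeal ℂ S)).unbotD 0).toNat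

/-- On nonempty sets the conversion to a natural number in `zariskiDim` loses nothing. -/
theorem coe_zariskiDim {σ : Type} [Finite σ] {S : Set (σ → ℂ)} (hS : S.Nonempty) :
    ((zariskiDim S : ℕ∞) : WithBot ℕ∞) =
      ringKrullDim (MvPolynomial σ ℂ ⧸ vanishingIdeal ℂ S) := by
  have hne : vanishingIdeal ℂ S ≠ ⊤ := by
    obtain ⟨x, hx⟩ := hS
    intro h
    have h1 : (1 : MvPolynomial σ ℂ) ∈ vanishingIdeal ℂ S := h ▸ Submodule.mem_top
    simpa using h1 x hx
  have : Nontrivial (MvPolynomial σ ℂ ⧸ vanishingIdeal ℂ S) := Ideal.Quotient.nontrivial_iff.2 hne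
  have h0 := ringKrullDim_nonneg_of_nontrivial (R := MvPolynomial σ ℂ ⧸ vanishingIdeal ℂ S)
  have h1 := ringKrullDim_quotient_le (vanishingIdeal ℂ S)
  rw [MvPolynomial.ringKrullDim_of_isNoetherianRing, ringKrullDim_eq_zero_of_field, zero_add] at h1
  unfold zariskiDim
  generalize ringKrullDim (MvPolynomial σ ℂ ⧸ vanishingIdeal ℂ S) = d at h0 h1
  induction d with
  | bot => simp at h0
  | coe d =>
    have hd : d ≠ ⊤ := by
      rintro rfl
      have h2 : ((⊤ : ℕ∞) : WithBot ℕ∞) ≤ ((Nat.card σ : ℕ∞) : WithBot ℕ∞) := h1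
      rw [WithBot.coe_le_coe] at h2
      simp at h2
    simp [ENat.natCast_toNat hd]

/-- The closed embedding of `GL_n(ℂ)` into affine space by the matrix entries and the inverse of
the determinant; its coordinate ring is `ℂ[x_ij, 1/det]`. -/
def glCoord (n : ℕ) (g : GL (Fin n) ℂ) : (Fin n × Fin n) ⊕ Unit → ℂ :=
  Sum.elim (fun ij => (g : Matrix (Fin n) (Fin n) ℂ) ij.1 ij.2)
    (fun _ => (g : Matrix (Fin n) (Fin n) ℂ).det⁻¹)

/-- The induced closed embedding of `GL_n(ℂ) × GL_n(ℂ)` into affine space. -/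
def glPairCoord (n : ℕ) (x : GL (Fin n) ℂ × GL (Fin n) ℂ) :
    ((Fin n × Fin n) ⊕ Unit) ⊕ ((Fin n × Fin n) ⊕ Unit) → ℂ :=
  Sum.elim (glCoord n x.1) (glCoord n x.2)

/-- The Zariski topology on `GL_n(ℂ)`. -/
@[reducible] def glZariski (n : ℕ) : TopologicalSpace (GL (Fin n) ℂ) :=
  (zariskiTopology ((Fin n × Fin n) ⊕ Unit)).induced (glCoord n)

/-- A (complex) linear algebraic group: a Zariski closed subgroup of some `GL_n(ℂ)`. -/
structure LinearAlgebraicGroup where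
  /-- the size of the matrices -/
  n : ℕ
  /-- the group of complex points -/
  points : Subgroup (GL (Fin n) ℂ)
  /-- the group is Zariski closed -/
  isClosed_points : IsClosed[glZariski n] (points : Set (GL (Fin n) ℂ))

namespace LinearAlgebraicGroup

/-- `G` is connected in the Zariski topology. -/
def Connected (G : LinearAlgebraicGroup) : Prop :=
  @IsConnected _ (glZariski G.n) (G.points : Set (GL (Fin G.n) ℂ))

/-- `G` is nilpotent as a group. -/
def Nilpotent (G : LinearAlgebraicGroup) : Prop :=
  Group.IsNilpotent G.points

/-- The dimension of `G`. -/
def dim (G : LinearAlgebraicGroup) : ℕ :=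
  zariskiDim (glCoord G.n '' (G.points : Set (GL (Fin G.n) ℂ)))

/-- The Zariski closed set `C(G) = {(a, b) ∈ G × G : ab = ba}` of commuting pairs. -/
def commutingPairs (G : LinearAlgebraicGroup) : Set (GL (Fin G.n) ℂ × GL (Fin G.n) ℂ) :=
  {x | x.1 ∈ G.points ∧ x.2 ∈ G.points ∧ x.1 * x.2 = x.2 * x.1}

/-- The dimension of `C(G)`. -/
def dimCommutingPairs (G : LinearAlgebraicGroup) : ℕ :=
  zariskiDim (glPairCoord G.n '' G.commutingPairs)

/-- The commuting probability `p(G) = dim C(G) / (2 dim G)`, with `p(G) = 1` if `dim G = 0`. -/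
def commutingProbability (G : LinearAlgebraicGroup) : ℚ :=
  if G.dim = 0 then 1 else (G.dimCommutingPairs : ℚ) / (2 * (G.dim : ℚ))

end LinearAlgebraicGroup

end

/-! The groups are truncated substitution groups. For `m ≥ 1` let `G` consist of the substitutions t
↦ t + O(t^(m+1)) modulo t^(n+2), acting on polynomials in t modulo t^(n+2). In matrices, `G` is a
closed unitriangular group, hence nilpotent. The coefficients of t^(m+1), ..., t^(n+1) identify it
with an affine space, so it is connected of dimension n + 1 - m.

The point is that C(G) has dimension n + 2 when n = 2h and m ≤ h, whatever `m` is. For the lower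
bound, two substitutions of the form t + O(t^(h+1)) commute modulo t^(2h+2) (`IsJet.commute`), and
such pairs form an affine space of dimension 2(h + 1). For the upper bound, take a commuting pair f
= t u, g = t w over a field, with u = 1 + u_k t^k + ... and u_k ≠ 0. Comparing coefficients of
t^(k+j+1) in f ∘ g = g ∘ f determines (j - k) u_k w_j from u and the earlier w_s
(`leading_mul_coeff_mem`). In characteristic zero only u_k, ..., u_n, w_k and the last k
coefficients of w remain free, n + 2 in all (`exists_generators_of_commute`). Applied to the generic
point of each irreducible subvariety, this bounds the dimension (`zariskiDim_le`).

Hence p(G) = (n + 2) / (2(n + 1 - m)), and varying `n` and `m` gives every rational in (1/2, 1]. -/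

noncomputable section

/-! ### Dimension of Zariski closures -/

/-- Incomparability: an integral extension does not raise the Krull dimension. -/
theorem ringKrullDim_le_of_isIntegral {A B : Type*} [CommRing A] [CommRing B] (f : A →+* B)
    (hf : f.IsIntegral) : ringKrullDim B ≤ ringKrullDim A := by
  algebraize [f]
  exact Order.krullDim_le_of_strictMono (PrimeSpectrum.comap f) fun p q hpq =>
    Ideal.IsIntegral.comap_lt_comap (R := A) (I := p.asIdeal) (J := q.asIdeal) hpq

/-- A finitely generated domain has dimension at most the number of generators of its field of
fractions. -/
theorem ringKrullDim_le_card_of_mem_adjoin (k : Type) {A K : Type} [Field k] [CommRing A]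
    [IsDomain A] [Field K] [Algebra k A] [Algebra A K] [Algebra k K] [IsScalarTower k A K]
    [Algebra.FiniteType k A] [IsFractionRing A K] (T : Finset K)
    (hT : ∀ a, algebraMap A K a ∈ IntermediateField.adjoin k (T : Set K)) :
    ringKrullDim A ≤ T.card := by
  -- Noether normalization: `s` bounds the dimension from above, and the `s` variables stay
  -- algebraically independent in `K`, so `s` is at most the transcendence degree.
  obtain ⟨s, g, hg, hfin⟩ := exists_finite_inj_algHom_of_fg k A
  have h1 : ringKrullDim A ≤ s := by
    refine (ringKrullDim_le_of_isIntegral g.toRingHom hfin.to_isIntegral).trans ?_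
    rw [MvPolynomial.ringKrullDim_of_isNoetherianRing, ringKrullDim_eq_zero_of_field]
    simp
  refine h1.trans ?_
  have halg : Algebra.IsAlgebraic (Algebra.adjoin k (T : Set K)) K := by
    refine ⟨fun x => ?_⟩
    have htop : x ∈ IntermediateField.adjoin k (T : Set K) := by
      obtain ⟨a, b, -, rfl⟩ := IsFractionRing.div_surjective (A := A) x
      exact div_mem (hT a) (hT b)
    obtain ⟨r, hr, t, ht, rfl⟩ := IntermediateField.mem_adjoin_iff_div.1 htop
    rw [div_eq_mul_inv]
    exact (isAlgebraic_algebraMap (⟨r, hr⟩ : Algebra.adjoin k (T : Set K))).mul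
      (isAlgebraic_algebraMap (⟨t, ht⟩ : Algebra.adjoin k (T : Set K))).inv
  have h2 : Cardinal.mk (Fin s) ≤ Algebra.trdeg k K := by
    have hinj : Function.Injective ((IsScalarTower.toAlgHom k A K).comp g) :=
      (IsFractionRing.injective A K).comp hg
    exact ((algebraicIndependent_X (Fin s) k).map' hinj).cardinalMk_le_trdeg
  have h3 := h2.trans (Algebra.IsAlgebraic.trdeg_le_cardinalMk (R := k) (s := (T : Set K)))
  simp at h3
  exact_mod_cast h3

/-- A chain of primes over `I` is a chain over its own smallest member, so only irreducible
subvarieties matter. -/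
theorem ringKrullDim_quotient_le_of_forall_isPrime {R : Type*} [CommRing R] (I : Ideal R)
    (D : WithBot ℕ∞) (h : ∀ p : Ideal R, p.IsPrime → I ≤ p → ringKrullDim (R ⧸ p) ≤ D) :
    ringKrullDim (R ⧸ I) ≤ D := by
  rw [ringKrullDim_quotient]
  refine iSup_le fun s => ?_
  refine le_trans ?_ (h s.head.1.asIdeal s.head.1.2 s.head.2)
  rw [ringKrullDim_quotient]
  let s' : LTSeries (PrimeSpectrum.zeroLocus (s.head.1.asIdeal : Set R)) :=
    { length := s.length
      toFun := fun i => ⟨(s i).1, (LTSeries.head_le s i : s.head ≤ s i)⟩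
      step := fun i => s.step i }
  exact le_iSup (fun s : LTSeries (PrimeSpectrum.zeroLocus (s.head.1.asIdeal : Set R)) =>
    ((s.length : ℕ∞) : WithBot ℕ∞)) s'


/-- Each prime containing the vanishing ideal has a generic point, with coordinates in the fraction
field of the quotient. The hypothesis at that point bounds the dimension of the quotient, so
dimension bounds reduce to calculations with points over fields. -/
theorem zariskiDim_le {σ : Type} [Finite σ] (S : Set (σ → ℂ)) (hS : S.Nonempty) (D : ℕ)
    (h : ∀ (K : Type) [Field K] [Algebra ℂ K] (x : σ → K),
      (∀ q ∈ vanishingIdeal ℂ S, aeval x q = 0) →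
      ∃ T : Finset K, T.card ≤ D ∧ ∀ i, x i ∈ IntermediateField.adjoin ℂ (T : Set K)) :
    zariskiDim S ≤ D := by
  have key : ringKrullDim (MvPolynomial σ ℂ ⧸ vanishingIdeal ℂ S) ≤ D := by
    refine ringKrullDim_quotient_le_of_forall_isPrime _ _ fun p hp hle => ?_
    let A := MvPolynomial σ ℂ ⧸ p
    let K := FractionRing A
    let f : MvPolynomial σ ℂ →ₐ[ℂ] K :=
      (IsScalarTower.toAlgHom ℂ A K).comp (Ideal.Quotient.mkₐ ℂ p)
    have hf : aeval (fun i => f (X i)) = f := by ext; simp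
    obtain ⟨T, hT, hx⟩ := h K (fun i => f (X i)) fun q hq => by
      rw [hf]
      have : Ideal.Quotient.mk p q = 0 := Ideal.Quotient.eq_zero_iff_mem.2 (hle hq)
      change algebraMap A K (Ideal.Quotient.mk p q) = 0
      rw [this, map_zero]
    refine (ringKrullDim_le_card_of_mem_adjoin ℂ (A := A) (K := K) T fun a => ?_).trans
      (by exact_mod_cast hT)
    obtain ⟨q, rfl⟩ := Ideal.Quotient.mk_surjective a
    change f q ∈ _
    induction q using MvPolynomial.induction_on with
    | C a => exact f.commutes a ▸ IntermediateField.algebraMap_mem _ a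
    | add p q hp hq => rw [map_add]; exact add_mem hp hq
    | mul_X p i hp => rw [map_mul]; exact mul_mem hp (hx i)
  rw [← coe_zariskiDim hS] at key
  exact_mod_cast key

/-- A polynomial vanishing on all of ℂ^τ is zero, since ℂ is infinite. -/
theorem vanishingIdeal_range {σ τ : Type} (Φ : MvPolynomial σ ℂ →ₐ[ℂ] MvPolynomial τ ℂ) :
    vanishingIdeal ℂ (Set.range fun (u : τ → ℂ) i => aeval u (Φ (X i))) = RingHom.ker Φ := by
  ext p
  have h (u : τ → ℂ) : aeval (fun i => aeval u (Φ (X i))) p = eval u (Φ p) := by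
    rw [← aeval_eq_eval]
    change _ = ((aeval u).comp Φ) p
    congr 1
    ext; simp
  rw [mem_vanishingIdeal_iff, Set.forall_mem_range, RingHom.mem_ker]
  simp only [h]
  exact ⟨fun h => MvPolynomial.funext fun u => by simp [h], fun h => by simp [h]⟩

theorem ringKrullDim_mvPolynomial_complex (τ : Type) [Finite τ] :
    ringKrullDim (MvPolynomial τ ℂ) = (Nat.card τ : ℕ) := by
  rw [MvPolynomial.ringKrullDim_of_isNoetherianRing, ringKrullDim_eq_zero_of_field, zero_add]

/-- A set containing a closed affine space of dimension `d` has dimension at least `d`. -/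
theorem le_zariskiDim {σ τ : Type} [Finite σ] [Finite τ] (S : Set (σ → ℂ))
    (Φ : MvPolynomial σ ℂ →ₐ[ℂ] MvPolynomial τ ℂ) (hΦ : Function.Surjective Φ)
    (h : ∀ u : τ → ℂ, (fun i => aeval u (Φ (X i))) ∈ S) : Nat.card τ ≤ zariskiDim S := by
  have hS : S.Nonempty := ⟨_, h 0⟩
  have hle : vanishingIdeal ℂ S ≤ RingHom.ker Φ := by
    rw [← vanishingIdeal_range]
    exact vanishingIdeal_anti_mono (Set.range_subset_iff.2 h)
  have := ringKrullDim_le_of_surjective (Ideal.Quotient.lift (vanishingIdeal ℂ S) Φ.toRingHom hle)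
    (Ideal.Quotient.lift_surjective_of_surjective _ _ hΦ)
  rw [ringKrullDim_mvPolynomial_complex, ← coe_zariskiDim hS] at this
  exact_mod_cast this

theorem zariskiDim_range {σ τ : Type} [Finite σ] [Finite τ]
    (Φ : MvPolynomial σ ℂ →ₐ[ℂ] MvPolynomial τ ℂ) (hΦ : Function.Surjective Φ) :
    zariskiDim (Set.range fun (u : τ → ℂ) i => aeval u (Φ (X i))) = Nat.card τ := by
  have h := coe_zariskiDim (Set.range_nonempty fun (u : τ → ℂ) i => aeval u (Φ (X i)))
  rw [vanishingIdeal_range,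
    ringKrullDim_eq_of_ringEquiv (Ideal.quotientKerAlgEquivOfSurjective hΦ).toRingEquiv,
    ringKrullDim_mvPolynomial_complex] at h
  exact_mod_cast h

/-! ### Closed and connected subsets of GL_n -/

theorem isClosed_glZariski_of_forall {n : ℕ} {ι : Type*} (S : Set (GL (Fin n) ℂ))
    (p : ι → MvPolynomial ((Fin n × Fin n) ⊕ Unit) ℂ)
    (h : ∀ g, g ∈ S ↔ ∀ i, aeval (glCoord n g) (p i) = 0) : IsClosed[glZariski n] S := by
  let := zariskiTopology ((Fin n × Fin n) ⊕ Unit)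
  refine isClosed_induced_iff.2 ⟨zeroLocus ℂ (Ideal.span (Set.range p)),
    (isClosed_zariskiTopology_iff _).2 ⟨_, rfl⟩, ?_⟩
  ext g
  rw [zeroLocus_span]
  simp [h]

/-- The set is even irreducible: two disjoint nonempty open subsets would give two polynomials
outside the prime ideal whose product lies in it. -/
theorem isConnected_of_isPrime_vanishingIdeal {n : ℕ} (S : Set (GL (Fin n) ℂ)) (hS : S.Nonempty)
    (h : (vanishingIdeal ℂ (glCoord n '' S)).IsPrime) : @IsConnected _ (glZariski n) S := by
  let := zariskiTopology ((Fin n × Fin n) ⊕ Unit)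
  let := glZariski n
  refine ⟨hS, IsPreirreducible.isPreconnected ?_⟩
  have key (U : Set (GL (Fin n) ℂ)) (hU : IsOpen U) (hne : (S ∩ U).Nonempty) :
      ∃ p, p ∉ vanishingIdeal ℂ (glCoord n '' S) ∧ ∀ g, g ∉ U → aeval (glCoord n g) p = 0 := by
    obtain ⟨V, hV, rfl⟩ := isOpen_induced_iff.1 hU
    obtain ⟨I, hI⟩ := (isClosed_zariskiTopology_iff Vᶜ).1 hV.isClosed_compl
    obtain ⟨g, hgS, hgV⟩ := hne
    have hg : glCoord n g ∉ zeroLocus ℂ I := by rw [← hI]; exact fun h => h hgV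
    simp only [mem_zeroLocus_iff, not_forall] at hg
    obtain ⟨p, hp, hpg⟩ := hg
    refine ⟨p, fun hmem => hpg (hmem _ ⟨g, hgS, rfl⟩), fun g' hg' => ?_⟩
    have : glCoord n g' ∈ zeroLocus ℂ I := by rw [← hI]; exact hg'
    exact this p hp
  intro U V hU hV hSU hSV
  obtain ⟨p, hp, hpU⟩ := key U hU hSU
  obtain ⟨q, hq, hqV⟩ := key V hV hSV
  by_contra hcon
  refine (h.mem_or_mem (x := p) (y := q) ?_).elim hp hq
  rintro _ ⟨g, hg, rfl⟩
  rw [map_mul]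
  by_cases hgU : g ∈ U
  · have hgV : g ∉ V := fun hgV => hcon ⟨g, hg, hgU, hgV⟩
    rw [hqV g hgV, mul_zero]
  · rw [hpU g hgU, zero_mul]

/-! ### The filtration of triangular matrices by subdiagonals -/

/-- `A i j = 0` whenever `i < j + k`. -/
def Matrix.LowerBy {N : ℕ} {R : Type*} [CommRing R] (k : ℕ) (A : Matrix (Fin N) (Fin N) R) : Prop :=
  ∀ i j : Fin N, (i : ℕ) < j + k → A i j = 0

namespace Matrix.LowerBy

variable {N k l : ℕ} {R : Type*} [CommRing R] {A B M : Matrix (Fin N) (Fin N) R}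

theorem mono (hA : A.LowerBy l) (h : k ≤ l) : A.LowerBy k :=
  fun i j hij => hA i j (by omega)

theorem add (hA : A.LowerBy k) (hB : B.LowerBy k) : (A + B).LowerBy k :=
  fun i j hij => by simp [hA i j hij, hB i j hij]

theorem neg (hA : A.LowerBy k) : (-A).LowerBy k :=
  fun i j hij => by simp [hA i j hij]

theorem sub (hA : A.LowerBy k) (hB : B.LowerBy k) : (A - B).LowerBy k :=
  fun i j hij => by simp [hA i j hij, hB i j hij]

theorem mul (hA : A.LowerBy k) (hB : B.LowerBy l) : (A * B).LowerBy (k + l) := by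
  intro i j hij
  rw [Matrix.mul_apply]
  refine Finset.sum_eq_zero fun r _ => ?_
  by_cases hr : (i : ℕ) < r + k
  · rw [hA i r hr, zero_mul]
  · rw [hB r j (by omega), mul_zero]

theorem one : (1 : Matrix (Fin N) (Fin N) R).LowerBy 0 :=
  fun i j hij => Matrix.one_apply_ne (by omega)

theorem eq_zero (hA : A.LowerBy k) (h : N ≤ k) : A = 0 := by
  ext i j
  exact hA i j (by omega)

theorem of_sub_one (hM : (M - 1).LowerBy k) : M.LowerBy 0 := by
  simpa using (hM.mono (Nat.zero_le k)).add one

theorem mul_sub_one (hA : (A - 1).LowerBy k) (hB : (B - 1).LowerBy k) :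
    (A * B - 1).LowerBy k := by
  have : A * B - 1 = (A - 1) * B + (B - 1) := by noncomm_ring
  rw [this]
  exact (hA.mul hB.of_sub_one).add hB

theorem det_eq_one (hM : (M - 1).LowerBy 1) : M.det = 1 := by
  have h (i j : Fin N) (hij : i ≤ j) : M i j = (1 : Matrix (Fin N) (Fin N) R) i j :=
    sub_eq_zero.1 (hM i j (by have : (i : ℕ) ≤ j := hij; omega))
  rw [Matrix.det_of_isLowerTriangular]
  · simp [h]
  · intro i j hij
    have hij : i < j := hij
    rw [h i j hij.le, Matrix.one_apply_ne hij.ne]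

theorem inv_sub_one (hM : (M - 1).LowerBy k) (hk : 1 ≤ k) : (M⁻¹ - 1).LowerBy k := by
  have hdet : IsUnit M.det := by rw [det_eq_one (hM.mono hk)]; exact isUnit_one
  have h0 : M⁻¹.LowerBy 0 := by
    have : Invertible M := Matrix.invertibleOfIsUnitDet M hdet
    have hb : M.BlockTriangular OrderDual.toDual := fun i j hij =>
      hM.of_sub_one i j (by have : i < j := hij; simpa using this)
    intro i j hij
    exact Matrix.blockTriangular_inv_of_blockTriangular hb (show j > i by simpa using hij)
  have : M⁻¹ - 1 = -(M⁻¹ * (M - 1)) := by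
    rw [mul_sub, Matrix.nonsing_inv_mul _ hdet]; noncomm_ring
  rw [this]
  simpa using (h0.mul hM).neg

/-- Commuting with `1 + B` moves `A` one step down. -/
theorem commutator (hA : (A - 1).LowerBy k) (hB : (B - 1).LowerBy 1) (hk : 1 ≤ k) :
    (A * B * A⁻¹ * B⁻¹ - 1).LowerBy (k + 1) := by
  have hdA : IsUnit A.det := by rw [det_eq_one (hA.mono hk)]; exact isUnit_one
  have hdB : IsUnit B.det := by rw [det_eq_one hB]; exact isUnit_one
  have : A * B * A⁻¹ * B⁻¹ - 1 =
      ((A - 1) * (B - 1) - (B - 1) * (A - 1)) * (A⁻¹ * B⁻¹) := by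
    have h1 : B * A * (A⁻¹ * B⁻¹) = 1 := by
      rw [mul_assoc, ← mul_assoc A, Matrix.mul_nonsing_inv _ hdA, one_mul,
        Matrix.mul_nonsing_inv _ hdB]
    have h2 : (A - 1) * (B - 1) - (B - 1) * (A - 1) = A * B - B * A := by noncomm_ring
    rw [h2, sub_mul, h1, ← mul_assoc]
  rw [this]
  have h3 := (hA.inv_sub_one hk).of_sub_one.mul (hB.inv_sub_one le_rfl).of_sub_one
  exact ((hA.mul hB).sub (Nat.add_comm 1 k ▸ hB.mul hA)).mul h3

end Matrix.LowerBy

/-! ### Substitutions as matrices -/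

section Jets

variable {R S : Type*} [CommRing R] [CommRing S] {n m : ℕ}

/-- The matrix of the substitution `t ↦ f(t)` on `R[t] / (t ^ (n + 2))`. -/
def jetMatrix (n : ℕ) (f : Polynomial R) : Matrix (Fin (n + 2)) (Fin (n + 2)) R :=
  Matrix.of fun i j => (f ^ (j : ℕ)).coeff i

theorem jetMatrix_apply (f : Polynomial R) (i j : Fin (n + 2)) :
    jetMatrix n f i j = (f ^ (j : ℕ)).coeff i := rfl

theorem jetMatrix_apply_one (f : Polynomial R) (i : Fin (n + 2)) :
    jetMatrix n f i 1 = f.coeff i := by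
  simp [jetMatrix_apply]

theorem jetMatrix_map (f : Polynomial R) (φ : R →+* S) :
    (jetMatrix n f).map φ = jetMatrix n (f.map φ) := by
  ext i j
  simp [jetMatrix_apply, ← Polynomial.map_pow]

theorem jetMatrix_X : jetMatrix n (Polynomial.X : Polynomial R) = 1 := by
  ext i j
  simp [jetMatrix_apply, Polynomial.coeff_X_pow, Matrix.one_apply, Fin.ext_iff]

theorem jetMatrix_congr {f g : Polynomial R} (h : Polynomial.X ^ (n + 2) ∣ f - g) :
    jetMatrix n f = jetMatrix n g := by
  ext i j
  have := Polynomial.X_pow_dvd_iff.1 (h.trans (sub_dvd_pow_sub_pow f g j)) i i.2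
  rwa [Polynomial.coeff_sub, sub_eq_zero] at this

/-- Matrices act by p ↦ p ∘ f, which reverses composition. Divisibility of `f` by t makes the powers
f^k with k ≥ n + 2 invisible, so the truncated sum over columns suffices. -/
theorem jetMatrix_mul {f : Polynomial R} (hf : Polynomial.X ∣ f) (g : Polynomial R) :
    jetMatrix n f * jetMatrix n g = jetMatrix n (g.comp f) := by
  ext i j
  rw [Matrix.mul_apply, jetMatrix_apply, ← Polynomial.pow_comp]
  simp only [jetMatrix_apply]
  generalize g ^ (j : ℕ) = p
  have hlt : p.natDegree < max (p.natDegree + 1) (n + 2) := by omega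
  rw [Polynomial.comp_eq_sum_left, Polynomial.sum_over_range' _ (by simp) _ hlt,
    Polynomial.finsetSum_coeff]
  simp only [Polynomial.coeff_C_mul]
  rw [← Finset.sum_subset (Finset.range_mono (le_max_right (p.natDegree + 1) (n + 2))),
    ← Fin.sum_univ_eq_sum_range fun k => p.coeff k * (f ^ k).coeff i]
  · exact Finset.sum_congr rfl fun k _ => mul_comm _ _
  · intro k _ hk
    rw [Finset.mem_range, not_lt] at hk
    rw [Polynomial.X_pow_dvd_iff.1 (pow_dvd_pow_of_dvd hf k) i (by omega), mul_zero]

theorem exists_eq_X_mul {f : Polynomial R} (h : Polynomial.X ^ (m + 1) ∣ f - Polynomial.X) :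
    ∃ u, f = Polynomial.X * (1 + Polynomial.X ^ m * u) := by
  obtain ⟨u, hu⟩ := h
  exact ⟨u, by linear_combination hu⟩

theorem jetMatrix_sub_one_lowerBy {f : Polynomial R} (h : Polynomial.X ^ (m + 1) ∣ f - Polynomial.X) :
    (jetMatrix n f - 1).LowerBy m := by
  obtain ⟨u, rfl⟩ := exists_eq_X_mul h
  intro i j hij
  have hd : Polynomial.X ^ ((j : ℕ) + m) ∣ (Polynomial.X * (1 + Polynomial.X ^ m * u)) ^ (j : ℕ) - Polynomial.X ^ (j : ℕ) := by
    have h1 := sub_dvd_pow_sub_pow (1 + Polynomial.X ^ m * u) 1 (j : ℕ)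
    rw [add_sub_cancel_left, one_pow] at h1
    rw [mul_pow, pow_add, ← mul_sub_one]
    exact mul_dvd_mul_left _ ((dvd_mul_right _ _).trans h1)
  have := Polynomial.X_pow_dvd_iff.1 hd i hij
  rw [← jetMatrix_X (n := n)]
  simpa [jetMatrix_apply] using this

/-- The matrix of a substitution `t ↦ t + O(t ^ (m + 1))` modulo `t ^ (n + 2)`. -/
def IsJet (m : ℕ) (M : Matrix (Fin (n + 2)) (Fin (n + 2)) R) : Prop :=
  (M - 1).LowerBy m ∧ M = jetMatrix n (∑ k : Fin (n + 2), Polynomial.C (M k 1) * Polynomial.X ^ (k : ℕ))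

theorem coeff_sum_fin (v : Fin (n + 2) → R) (i : Fin (n + 2)) :
    (∑ k : Fin (n + 2), Polynomial.C (v k) * Polynomial.X ^ (k : ℕ)).coeff i = v i := by
  simp [Polynomial.finsetSum_coeff, Polynomial.coeff_X_pow, Fin.val_inj]

theorem X_pow_dvd_sub_X {M : Matrix (Fin (n + 2)) (Fin (n + 2)) R} (h : (M - 1).LowerBy m) :
    Polynomial.X ^ (m + 1) ∣ (∑ k : Fin (n + 2), Polynomial.C (M k 1) * Polynomial.X ^ (k : ℕ)) - Polynomial.X := by
  rw [Polynomial.X_pow_dvd_iff]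
  intro i hi
  by_cases hn : i < n + 2
  · have h1 := h ⟨i, hn⟩ 1 (by simpa [add_comm] using hi)
    rw [Polynomial.coeff_sub, coeff_sum_fin _ ⟨i, hn⟩]
    rw [← jetMatrix_X (n := n)] at h1
    simpa [jetMatrix_apply] using h1
  · simp only [Polynomial.coeff_sub, Polynomial.finsetSum_coeff, Polynomial.coeff_C_mul,
      Polynomial.coeff_X_pow, Polynomial.coeff_X]
    rw [if_neg (by omega), sub_zero]
    exact Finset.sum_eq_zero fun k _ => by rw [if_neg (by omega), mul_zero]

/-- Column 1 of `jetMatrix n f` lists the coefficients of `f`. The definition of `IsJet` is thus a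
system of polynomial equations in the entries, while this form is the one suited to composition. -/
theorem isJet_iff {M : Matrix (Fin (n + 2)) (Fin (n + 2)) R} :
    IsJet m M ↔ ∃ f, Polynomial.X ^ (m + 1) ∣ f - Polynomial.X ∧ M = jetMatrix n f := by
  constructor
  · exact fun h => ⟨_, X_pow_dvd_sub_X h.1, h.2⟩
  · rintro ⟨f, hf, rfl⟩
    refine ⟨jetMatrix_sub_one_lowerBy hf, jetMatrix_congr (Polynomial.X_pow_dvd_iff.2 ?_)⟩
    intro i hi
    rw [Polynomial.coeff_sub, coeff_sum_fin _ ⟨i, hi⟩, jetMatrix_apply_one, sub_self]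

theorem IsJet.map {M : Matrix (Fin (n + 2)) (Fin (n + 2)) R} (h : IsJet m M) (φ : R →+* S) :
    IsJet m (M.map φ) := by
  obtain ⟨f, hf, rfl⟩ := isJet_iff.1 h
  refine isJet_iff.2 ⟨f.map φ, ?_, jetMatrix_map f φ⟩
  simpa using map_dvd (Polynomial.mapRingHom φ) hf

theorem X_dvd_of_X_pow_dvd_sub {f : Polynomial R} (h : Polynomial.X ^ (m + 1) ∣ f - Polynomial.X) : Polynomial.X ∣ f := by
  obtain ⟨u, rfl⟩ := exists_eq_X_mul h
  exact dvd_mul_right _ _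

theorem isJet_one : IsJet m (1 : Matrix (Fin (n + 2)) (Fin (n + 2)) R) :=
  isJet_iff.2 ⟨Polynomial.X, by simp, jetMatrix_X.symm⟩

theorem IsJet.mul {M M' : Matrix (Fin (n + 2)) (Fin (n + 2)) R} (h : IsJet m M)
    (h' : IsJet m M') : IsJet m (M * M') := by
  obtain ⟨f, hf, rfl⟩ := isJet_iff.1 h
  obtain ⟨g, hg, rfl⟩ := isJet_iff.1 h'
  refine isJet_iff.2 ⟨g.comp f, ?_, jetMatrix_mul (X_dvd_of_X_pow_dvd_sub hf) g⟩
  have h1 : f ^ (m + 1) ∣ g.comp f - f := by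
    obtain ⟨r, hr⟩ := hg
    exact ⟨r.comp f, by simpa using congrArg (fun p => p.comp f) hr⟩
  have := ((pow_dvd_pow_of_dvd (X_dvd_of_X_pow_dvd_sub hf) _).trans h1).add hf
  simpa using this

theorem IsJet.inv {M : Matrix (Fin (n + 2)) (Fin (n + 2)) R} (h : IsJet m M) (hm : 1 ≤ m) :
    IsJet m M⁻¹ := by
  have hdet : IsUnit M.det := by rw [(h.1.mono hm).det_eq_one]; exact isUnit_one
  have hinv := h.1.inv_sub_one hm
  obtain ⟨f, hf, hM⟩ := isJet_iff.1 h
  -- The inverse substitution is read off column 1 of `M⁻¹`. Comparing only column 1 of the product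
  -- with that of the identity gives g ∘ f ≡ t, which then forces equality of the whole matrices.
  set g := ∑ k : Fin (n + 2), Polynomial.C (M⁻¹ k 1) * Polynomial.X ^ (k : ℕ) with hg
  refine isJet_iff.2 ⟨g, X_pow_dvd_sub_X hinv, Matrix.inv_eq_right_inv ?_⟩
  rw [hM, jetMatrix_mul (X_dvd_of_X_pow_dvd_sub hf), ← jetMatrix_X]
  refine jetMatrix_congr (Polynomial.X_pow_dvd_iff.2 fun i hi => ?_)
  have h1 : (M * jetMatrix n g) ⟨i, hi⟩ 1 = (M * M⁻¹) ⟨i, hi⟩ 1 := by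
    simp only [Matrix.mul_apply, jetMatrix_apply_one, hg, coeff_sum_fin]
  rw [Matrix.mul_nonsing_inv _ hdet, hM, jetMatrix_mul (X_dvd_of_X_pow_dvd_sub hf),
    jetMatrix_apply_one, ← jetMatrix_X, jetMatrix_apply_one] at h1
  rw [Polynomial.coeff_sub, h1, sub_self]

end Jets

/-! ### Leading terms of commuting substitutions -/

section LeadingTerms

variable {K : Type*} [Field K]

theorem coeff_pow_mem (E : Subring K) (u : Polynomial K) (r l : ℕ)
    (h : ∀ s ≤ r, u.coeff s ∈ E) : (u ^ l).coeff r ∈ E := by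
  induction l generalizing r with
  | zero =>
    rw [pow_zero, Polynomial.coeff_one]
    split_ifs
    exacts [one_mem _, zero_mem _]
  | succ l ih =>
    rw [pow_succ, Polynomial.coeff_mul]
    refine sum_mem fun p hp => ?_
    rw [Finset.HasAntidiagonal.mem_antidiagonal] at hp
    exact mul_mem (ih _ fun s hs => h s (by omega)) (h _ (by omega))

theorem coeff_zero_pow_eq_one {u : Polynomial K} (h0 : u.coeff 0 = 1) (l : ℕ) :
    (u ^ l).coeff 0 = 1 := by
  rw [Polynomial.coeff_zero_eq_eval_zero] at *
  simp [h0]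

/-- Modulo the lower coefficients, the coefficient of `t ^ r` in `u ^ l` is `l u_r`. -/
theorem coeff_pow_sub_mem (E : Subring K) (u : Polynomial K) (r l : ℕ) (hr : 1 ≤ r)
    (h0 : u.coeff 0 = 1) (h : ∀ s < r, u.coeff s ∈ E) :
    (u ^ l).coeff r - l * u.coeff r ∈ E := by
  induction l with
  | zero => simp [Polynomial.coeff_one, show r ≠ 0 by omega]
  | succ l ih =>
    have key : (u ^ (l + 1)).coeff r - ((u ^ l).coeff r + u.coeff r) ∈ E := by
      have hr0 : (r, 0) ∈ Finset.HasAntidiagonal.antidiagonal r := by simp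
      have h0r : (0, r) ∈ (Finset.HasAntidiagonal.antidiagonal r).erase (r, 0) := by
        simp; omega
      rw [pow_succ, Polynomial.coeff_mul, ← Finset.add_sum_erase _ _ hr0,
        ← Finset.add_sum_erase _ _ h0r, h0, coeff_zero_pow_eq_one h0]
      simp only [mul_one, one_mul]
      rw [← add_assoc, add_sub_cancel_left]
      refine sum_mem fun p hp => ?_
      obtain ⟨p, q⟩ := p
      simp only [Finset.mem_erase, Finset.HasAntidiagonal.mem_antidiagonal, ne_eq, Prod.mk.injEq] at hp
      exact mul_mem (coeff_pow_mem E u _ _ fun s hs => h s (by omega)) (h _ (by omega))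
    have := add_mem key ih
    push_cast
    convert this using 1
    ring

/-- With u = 1 + t^k w, the binomial expansion is u^l = 1 + l t^k w + O(t^(2k)). -/
theorem coeff_pow_of_gap {u : Polynomial K} {k : ℕ} (hk : 1 ≤ k) (h0 : u.coeff 0 = 1)
    (h : ∀ s, 1 ≤ s → s < k → u.coeff s = 0) (l : ℕ) :
    (∀ s, 1 ≤ s → s < k → (u ^ l).coeff s = 0) ∧ (u ^ l).coeff k = l * u.coeff k := by
  have hd : Polynomial.X ^ k ∣ u - 1 := by
    refine Polynomial.X_pow_dvd_iff.2 fun s hs => ?_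
    rcases Nat.eq_zero_or_pos s with rfl | hs0
    · simp [h0]
    · simp [h s hs0 hs, Polynomial.coeff_one, hs0.ne']
  obtain ⟨w, hw⟩ := hd
  obtain rfl : u = 1 + Polynomial.X ^ k * w := by linear_combination hw
  obtain ⟨c, hc⟩ := Polynomial.powAddExpansion 1 (Polynomial.X ^ k * w) l
  have hc' : (1 + Polynomial.X ^ k * w) ^ l =
      1 + Polynomial.X ^ k * ((l : Polynomial K) * w + Polynomial.X ^ k * (c * w ^ 2)) := by
    rw [hc]; ring
  rw [hc']
  constructor
  · intro s hs1 hs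
    simp [Polynomial.coeff_X_pow_mul', Polynomial.coeff_one, hs.not_ge, show s ≠ 0 by omega]
  · have h1 (q : Polynomial K) : (1 + Polynomial.X ^ k * q).coeff k = q.coeff 0 := by
      simp [Polynomial.coeff_X_pow_mul', Polynomial.coeff_one, show k ≠ 0 by omega]
    rw [h1, h1, Polynomial.coeff_add, ← Polynomial.C_eq_natCast, Polynomial.coeff_C_mul,
      Polynomial.coeff_X_pow_mul', if_neg (by omega), add_zero]

theorem jetMatrix_X_mul_apply {n : ℕ} (u : Polynomial K) (i j : Fin (n + 2)) :
    jetMatrix n (Polynomial.X * u) i j =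
      if (j : ℕ) ≤ i then (u ^ (j : ℕ)).coeff (i - j) else 0 := by
  rw [jetMatrix_apply, mul_pow, Polynomial.coeff_X_pow_mul']

/-- If `t u` has leading exponent `k` and commutes with `t w`, the coefficient `w_j` is determined,
up to the factor `(j - k) u_k`, by `u` and the lower coefficients of `w`. -/
theorem leading_mul_coeff_mem {n : ℕ} (E : Subring K) (u w : Polynomial K) (j k : ℕ)
    (hu0 : u.coeff 0 = 1) (hw0 : w.coeff 0 = 1) (hk : 1 ≤ k) (hj : 1 ≤ j) (hjk : j + k ≤ n)
    (hgap : ∀ s, 1 ≤ s → s < k → u.coeff s = 0) (hu : ∀ s, u.coeff s ∈ E)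
    (hw : ∀ s < j, w.coeff s ∈ E)
    (hcomm : jetMatrix n (Polynomial.X * u) * jetMatrix n (Polynomial.X * w) =
      jetMatrix n (Polynomial.X * w) * jetMatrix n (Polynomial.X * u)) :
    ((j : K) - k) * (u.coeff k * w.coeff j) ∈ E := by
  have hi : k + j + 1 < n + 2 := by omega
  -- `F u w l` is the l-th summand of the coefficient of t^(k+j+1) in g ∘ f, where f = t u and g = t
  -- w. The bound j + k ≤ n keeps this coefficient within the truncation.
  set F : Polynomial K → Polynomial K → ℕ → K := fun u w l =>
    (if l ≤ k + j + 1 then (u ^ l).coeff (k + j + 1 - l) else 0) *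
      (if 1 ≤ l then w.coeff (l - 1) else 0) with hF
  have hprod (u w : Polynomial K) :
      (jetMatrix n (Polynomial.X * u) * jetMatrix n (Polynomial.X * w) :
        Matrix (Fin (n + 2)) (Fin (n + 2)) K) ⟨k + j + 1, hi⟩ 1 =
        ∑ l ∈ Finset.range (n + 2), F u w l := by
    rw [Matrix.mul_apply, ← Fin.sum_univ_eq_sum_range (F u w)]
    refine Finset.sum_congr rfl fun l _ => ?_
    simp only [jetMatrix_X_mul_apply, hF]
    simp
  have hsum : ∑ l ∈ Finset.range (n + 2), F u w l = ∑ l ∈ Finset.range (n + 2), F w u l := by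
    rw [← hprod, ← hprod, hcomm]
  -- Modulo `E`, only l = j + 1 and l = k + j + 1 contribute: smaller l involve known w_s, and those
  -- strictly between vanish by the gap in `u`.
  have hL (l : ℕ) : F u w l - (if l = k + j + 1 then w.coeff (k + j) else 0) -
      (if l = j + 1 then (j + 1) * (u.coeff k * w.coeff j) else 0) ∈ E := by
    rcases Nat.eq_zero_or_pos l with rfl | hl
    · simp [hF]
    obtain ⟨l, rfl⟩ := Nat.exists_eq_add_of_le' hl
    rcases lt_or_ge (k + j) l with hlt | hle
    · simp [hF, hlt.not_ge, hlt.ne', show l ≠ j by omega]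
    have hFl : F u w (l + 1) = (u ^ (l + 1)).coeff (k + j - l) * w.coeff l := by
      simp [hF, hle]
    rw [hFl]
    simp only [Nat.add_right_cancel_iff]
    obtain ⟨hgap1, hgap2⟩ := coeff_pow_of_gap hk hu0 hgap (l + 1)
    rcases lt_trichotomy l j with hlj | rfl | hlj
    · rw [if_neg (by omega), if_neg (by omega), sub_zero, sub_zero]
      exact mul_mem (coeff_pow_mem E u _ _ fun s _ => hu s) (hw l hlj)
    · rw [if_neg (by omega), if_pos rfl, Nat.add_sub_cancel, hgap2]
      push_cast
      convert zero_mem E using 1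
      ring
    · rw [if_neg (show l ≠ j by omega), sub_zero]
      rcases eq_or_lt_of_le hle with rfl | hlt
      · simp [coeff_zero_pow_eq_one hu0]
      · rw [if_neg (by omega), hgap1 _ (by omega) (by omega)]
        simp
  -- In the opposite order the contributions are l = 1 and l = k + 1. The term w_(k+j) is the same
  -- on both sides and cancels, leaving the factor (j + 1) - (k + 1).
  have hR (l : ℕ) : F w u l - (if l = 1 then w.coeff (k + j) else 0) -
      (if l = k + 1 then (k + 1) * (u.coeff k * w.coeff j) else 0) ∈ E := by
    rcases Nat.eq_zero_or_pos l with rfl | hl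
    · simp [hF]
    obtain ⟨l, rfl⟩ := Nat.exists_eq_add_of_le' hl
    rcases lt_or_ge (k + j) l with hlt | hle
    · simp [hF, hlt.not_ge, show l ≠ 0 by omega, show l ≠ k by omega]
    have hFl : F w u (l + 1) = (w ^ (l + 1)).coeff (k + j - l) * u.coeff l := by
      simp [hF, hle]
    rw [hFl]
    simp only [Nat.add_right_cancel_iff, Nat.add_eq_right]
    rcases Nat.eq_zero_or_pos l with rfl | hl
    · simp [hu0, show ¬ 0 = k by omega]
    rw [if_neg (by omega), sub_zero]
    rcases lt_trichotomy l k with hlk | rfl | hlk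
    · rw [if_neg (by omega), hgap l hl hlk]
      simp
    · rw [if_pos rfl, Nat.add_sub_cancel_left]
      have := mul_mem (coeff_pow_sub_mem E w j (l + 1) hj hw0 hw) (hu l)
      push_cast at this
      convert this using 1
      ring
    · rw [if_neg (by omega), sub_zero]
      exact mul_mem (coeff_pow_mem E w _ _ fun s hs => hw s (by omega)) (hu l)
  have h1 := sum_mem (t := Finset.range (n + 2)) fun l _ => hL l
  have h2 := sum_mem (t := Finset.range (n + 2)) fun l _ => hR l
  simp only [Finset.sum_sub_distrib, Finset.sum_ite_eq', Finset.mem_range] at h1 h2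
  rw [if_pos (by omega), if_pos (by omega)] at h1 h2
  rw [hsum] at h1
  convert sub_mem h2 h1 using 1
  ring

end LeadingTerms

theorem IsJet.exists_eq_X_mul {R : Type*} [CommRing R] {n m : ℕ}
    {M : Matrix (Fin (n + 2)) (Fin (n + 2)) R} (h : IsJet m M) (hm : 1 ≤ m) :
    ∃ u : Polynomial R, u.coeff 0 = 1 ∧ (∀ s, 1 ≤ s → s < m → u.coeff s = 0) ∧
      (∀ s, n < s → u.coeff s = 0) ∧ M = jetMatrix n (Polynomial.X * u) := by
  obtain ⟨w, hw⟩ := _root_.exists_eq_X_mul (X_pow_dvd_sub_X h.1)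
  refine ⟨1 + Polynomial.X ^ m * w, ?_, ?_, ?_, ?_⟩
  · simp [Polynomial.mul_coeff_zero, Polynomial.coeff_X_pow, show 0 ≠ m by omega]
  · intro s hs hsm
    simp [Polynomial.coeff_X_pow_mul', Polynomial.coeff_one, hsm.not_ge, show s ≠ 0 by omega]
  · intro s hs
    rw [← Polynomial.coeff_X_mul, ← hw, Polynomial.finsetSum_coeff]
    exact Finset.sum_eq_zero fun k _ => by
      rw [Polynomial.coeff_C_mul, Polynomial.coeff_X_pow, if_neg (by omega), mul_zero]
  · rw [← hw]
    exact h.2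

theorem jetMatrix_X_mul_mem {K : Type*} [Field K] {n : ℕ} (E : Subring K) {u : Polynomial K}
    (h : ∀ s, u.coeff s ∈ E) (i j : Fin (n + 2)) :
    jetMatrix n (Polynomial.X * u) i j ∈ E := by
  rw [jetMatrix_X_mul_apply]
  split_ifs
  exacts [coeff_pow_mem E u _ _ fun s _ => h s, zero_mem _]

/-- The coordinates of a commuting pair of jets over a field generate a field of transcendence
degree at most `n + 2`. -/
theorem exists_generators_of_commute {K : Type*} [Field K] [Algebra ℂ K] {n m : ℕ} (hm : 1 ≤ m)
    {M M' : Matrix (Fin (n + 2)) (Fin (n + 2)) K} (hM : IsJet m M) (hM' : IsJet m M')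
    (hcomm : M * M' = M' * M) :
    ∃ T : Finset K, T.card ≤ n + 2 ∧ (∀ i j, M i j ∈ IntermediateField.adjoin ℂ (T : Set K)) ∧
      ∀ i j, M' i j ∈ IntermediateField.adjoin ℂ (T : Set K) := by
  classical
  obtain ⟨u, hu0, -, hun, rfl⟩ := hM.exists_eq_X_mul hm
  obtain ⟨w, hw0, -, hwn, rfl⟩ := hM'.exists_eq_X_mul hm
  suffices h : ∃ T : Finset K, T.card ≤ n + 2 ∧
      (∀ s, u.coeff s ∈ IntermediateField.adjoin ℂ (T : Set K)) ∧
      ∀ s, w.coeff s ∈ IntermediateField.adjoin ℂ (T : Set K) by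
    obtain ⟨T, hT, hu, hw⟩ := h
    exact ⟨T, hT, jetMatrix_X_mul_mem (IntermediateField.adjoin ℂ (T : Set K)).toSubfield.toSubring hu,
      jetMatrix_X_mul_mem (IntermediateField.adjoin ℂ (T : Set K)).toSubfield.toSubring hw⟩
  by_cases hex : ∃ k, 1 ≤ k ∧ u.coeff k ≠ 0
  · obtain ⟨hk1, hk0⟩ := Nat.find_spec hex
    have hmin : ∀ s, 1 ≤ s → s < Nat.find hex → u.coeff s = 0 := fun s hs hlt => by
      by_contra hne
      exact Nat.find_min hex hlt ⟨hs, hne⟩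
    generalize Nat.find hex = k at hk1 hk0 hmin
    have hkn : k ≤ n := by
      by_contra hlt
      exact hk0 (hun k (by omega))
    -- The relation says nothing about w_k, where the factor s - k vanishes, nor about w_s with s >
    -- n - k, where it lies beyond the truncation. The count is (n + 1 - k) + 1 + k = n + 2.
    let T : Finset K := (Finset.Icc k n).image u.coeff ∪
      insert (w.coeff k) ((Finset.Ioc (n - k) n).image w.coeff)
    have hT : T.card ≤ n + 2 := by
      have h1 := Finset.card_image_le (s := Finset.Icc k n) (f := u.coeff)
      have h2 := Finset.card_image_le (s := Finset.Ioc (n - k) n) (f := w.coeff)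
      rw [Nat.card_Icc] at h1
      rw [Nat.card_Ioc] at h2
      refine (Finset.card_union_le _ _).trans ?_
      have h3 := Finset.card_insert_le (w.coeff k) ((Finset.Ioc (n - k) n).image w.coeff)
      omega
    set E := IntermediateField.adjoin ℂ (T : Set K) with hE
    have hTE : ∀ x ∈ T, x ∈ E := fun x hx => IntermediateField.subset_adjoin _ _ hx
    have hu : ∀ s, u.coeff s ∈ E := by
      intro s
      rcases Nat.eq_zero_or_pos s with rfl | hs
      · rw [hu0]; exact one_mem _
      rcases lt_or_ge s k with hsk | hsk
      · rw [hmin s hs hsk]; exact zero_mem _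
      rcases lt_or_ge n s with hns | hns
      · rw [hun s hns]; exact zero_mem _
      · exact hTE _ (Finset.mem_union_left _
          (Finset.mem_image_of_mem _ (Finset.mem_Icc.2 ⟨hsk, hns⟩)))
    refine ⟨T, hT, hu, fun s => ?_⟩
    induction s using Nat.strong_induction_on with
    | _ s ih =>
      rcases Nat.eq_zero_or_pos s with rfl | hs
      · rw [hw0]; exact one_mem _
      by_cases hsk : s = k
      · subst hsk
        exact hTE _ (Finset.mem_union_right _ (Finset.mem_insert_self _ _))
      rcases lt_or_ge n s with hns | hns
      · rw [hwn s hns]; exact zero_mem _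
      rcases lt_or_ge (n - k) s with hnk | hnk
      · exact hTE _ (Finset.mem_union_right _ (Finset.mem_insert_of_mem
          (Finset.mem_image_of_mem _ (Finset.mem_Ioc.2 ⟨hnk, hns⟩))))
      have key : ((s : K) - k) * (u.coeff k * w.coeff s) ∈ E :=
        leading_mul_coeff_mem E.toSubfield.toSubring u w s k hu0 hw0 hk1 hs (by omega) hmin hu ih
          hcomm
      have : CharZero K := charZero_of_injective_algebraMap (algebraMap ℂ K).injective
      have hne : (s : K) - k ≠ 0 := sub_ne_zero.2 (by exact_mod_cast hsk)
      have hsE : (s : K) - k ∈ E := sub_mem (natCast_mem _ _) (natCast_mem _ _)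
      have := mul_mem (inv_mem (mul_mem hsE (hu k))) key
      convert this using 1
      field_simp
  -- Here f = t, which commutes with everything, and the coefficients of `w` suffice.
  · push Not at hex
    refine ⟨(Finset.range (n + 1)).image w.coeff, ?_, fun s => ?_, fun s => ?_⟩
    · exact Finset.card_image_le.trans (by simp)
    · rcases Nat.eq_zero_or_pos s with rfl | hs
      · rw [hu0]; exact one_mem _
      · rw [hex s hs]; exact zero_mem _
    · rcases lt_or_ge n s with hns | hns
      · rw [hwn s hns]; exact zero_mem _
      · refine IntermediateField.subset_adjoin _ _ (Finset.mem_coe.2 ?_)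
        exact Finset.mem_image_of_mem _ (Finset.mem_range.2 (by omega))

/-- Deep jets commute: `f ∘ g = g ∘ f` modulo `t ^ (2 h + 2)` if `f` and `g` are
`t + O(t ^ (h + 1))`. -/
theorem IsJet.commute {R : Type*} [CommRing R] {h : ℕ} (hh : 1 ≤ h)
    {M M' : Matrix (Fin (2 * h + 2)) (Fin (2 * h + 2)) R} (hM : IsJet h M) (hM' : IsJet h M') :
    M * M' = M' * M := by
  obtain ⟨f, hf, rfl⟩ := isJet_iff.1 hM
  obtain ⟨g, hg, rfl⟩ := isJet_iff.1 hM'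
  obtain ⟨u, hu⟩ := hf
  obtain ⟨w, hw⟩ := hg
  obtain rfl : f = Polynomial.X + Polynomial.X ^ (h + 1) * u := by linear_combination hu
  obtain rfl : g = Polynomial.X + Polynomial.X ^ (h + 1) * w := by linear_combination hw
  -- Modulo t^(2h+2) the composite is symmetric in `u` and `w`. The quadratic remainder has order 3h
  -- + 1, which is at least 2h + 2 because h ≥ 1.
  have key (u w : Polynomial R) : Polynomial.X ^ (2 * h + 2) ∣
      (Polynomial.X + Polynomial.X ^ (h + 1) * w).comp (Polynomial.X + Polynomial.X ^ (h + 1) * u) -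
        (Polynomial.X + Polynomial.X ^ (h + 1) * (u + w) +
          ((h + 1 : ℕ) : Polynomial R) * Polynomial.X ^ (2 * h + 1) * (u * w)) := by
    obtain ⟨e, rfl⟩ := Nat.exists_eq_add_of_le' hh
    set f := Polynomial.X + Polynomial.X ^ (e + 1 + 1) * u with hf
    obtain ⟨q, hq⟩ : f - Polynomial.X ∣ w.comp f - w.comp Polynomial.X := by
      have := Polynomial.sub_dvd_eval_sub f Polynomial.X (w.map Polynomial.C)
      rwa [Polynomial.eval_map, Polynomial.eval_map] at this
    obtain ⟨c, hc⟩ := Polynomial.powAddExpansion 1 (Polynomial.X ^ (e + 1) * u) (e + 1 + 1)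
    have hfp : f ^ (e + 1 + 1) =
        Polynomial.X ^ (e + 1 + 1) * (1 + Polynomial.X ^ (e + 1) * u) ^ (e + 1 + 1) := by
      rw [← mul_pow, hf]; ring
    have hwf : w.comp f = w + Polynomial.X ^ (e + 1 + 1) * u * q := by
      rw [Polynomial.comp_X] at hq
      linear_combination hq + q * hf
    refine ⟨c * Polynomial.X ^ e * u ^ 2 * w +
      (1 + Polynomial.X ^ (e + 1) * u) ^ (e + 1 + 1) * u * q, ?_⟩
    rw [Polynomial.add_comp, Polynomial.mul_comp, Polynomial.X_pow_comp, Polynomial.X_comp, hfp, hwf,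
      hc, hf, one_pow, one_pow]
    ring
  rw [jetMatrix_mul (dvd_add dvd_rfl ((dvd_pow_self _ (Nat.succ_ne_zero h)).mul_right _)),
    jetMatrix_mul (dvd_add dvd_rfl ((dvd_pow_self _ (Nat.succ_ne_zero h)).mul_right _))]
  refine jetMatrix_congr ?_
  have := dvd_sub (key u w) (key w u)
  rwa [add_comm w u, mul_comm w u, sub_sub_sub_cancel_right] at this

/-! ### The jet group and its nilpotency -/

/-- The group of substitutions `t ↦ t + O(t ^ (m + 1))` modulo `t ^ (n + 2)`. -/
def jetGroup (n m : ℕ) (hm : 1 ≤ m) : LinearAlgebraicGroup where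
  n := n + 2
  points :=
    { carrier := {g | IsJet m (g : Matrix (Fin (n + 2)) (Fin (n + 2)) ℂ)}
      one_mem' := isJet_one
      mul_mem' := fun ha hb => IsJet.mul ha hb
      inv_mem' := fun {g} hg => by
        change IsJet m ((g⁻¹ : GL (Fin (n + 2)) ℂ) : Matrix (Fin (n + 2)) (Fin (n + 2)) ℂ)
        rw [Matrix.coe_units_inv]
        exact IsJet.inv hg hm }
  isClosed_points := by
    let G : Matrix (Fin (n + 2)) (Fin (n + 2))
        (MvPolynomial ((Fin (n + 2) × Fin (n + 2)) ⊕ Unit) ℂ) :=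
      Matrix.of fun i j => X (Sum.inl (i, j))
    -- The generic matrix rebuilt from its column 1; the equations G = P, together with the
    -- vanishing entries of G - 1, cut out the group.
    let P := jetMatrix n (∑ k : Fin (n + 2), Polynomial.C (G k 1) * Polynomial.X ^ (k : ℕ))
    refine isClosed_glZariski_of_forall _
      (Sum.elim (fun ij : Fin (n + 2) × Fin (n + 2) => if (ij.1 : ℕ) < ij.2 + m then (G - 1) ij.1 ij.2
        else 0)
        (fun ij : Fin (n + 2) × Fin (n + 2) => (G - P) ij.1 ij.2)) fun g => ?_
    let φ : MvPolynomial ((Fin (n + 2) × Fin (n + 2)) ⊕ Unit) ℂ →+* ℂ :=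
      (aeval (glCoord (n + 2) g)).toRingHom
    have hG (i j : Fin (n + 2)) :
        aeval (glCoord (n + 2) g) (G i j) = (g : Matrix (Fin (n + 2)) (Fin (n + 2)) ℂ) i j := by
      simp [G, glCoord]
    have hG1 (i j : Fin (n + 2)) : aeval (glCoord (n + 2) g) ((G - 1) i j) =
        ((g : Matrix (Fin (n + 2)) (Fin (n + 2)) ℂ) - 1) i j := by
      rw [Matrix.sub_apply, map_sub, hG, Matrix.sub_apply, Matrix.one_apply, Matrix.one_apply]
      split_ifs <;> simp
    have hP (i j : Fin (n + 2)) : aeval (glCoord (n + 2) g) (P i j) =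
        jetMatrix n (∑ k : Fin (n + 2),
          Polynomial.C ((g : Matrix (Fin (n + 2)) (Fin (n + 2)) ℂ) k 1) *
            Polynomial.X ^ (k : ℕ)) i j := by
      have h := congrFun (congrFun (jetMatrix_map (n := n)
        (∑ k : Fin (n + 2), Polynomial.C (G k 1) * Polynomial.X ^ (k : ℕ)) φ) i) j
      refine h.trans ?_
      simp only [Polynomial.map_sum, Polynomial.map_mul, Polynomial.map_C, Polynomial.map_pow,
        Polynomial.map_X]
      congr! 5
      exact hG _ _
    change IsJet m _ ↔ _
    rw [Sum.forall, IsJet, ← Matrix.ext_iff]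
    refine and_congr ?_ ?_
    · refine ⟨fun h ij => ?_, fun h i j hij => ?_⟩
      · dsimp only [Sum.elim_inl]
        split_ifs with hij
        · exact (hG1 _ _).trans (h _ _ hij)
        · exact map_zero _
      · have := h (i, j)
        dsimp only [Sum.elim_inl] at this
        rw [if_pos hij] at this
        rwa [hG1] at this
    · simp only [Prod.forall, Sum.elim_inr, Matrix.sub_apply, map_sub, hG, hP, sub_eq_zero]

section

variable {n m : ℕ} (hm : 1 ≤ m)

/-- The matrix of an element of the jet group. -/
def jetGroupMatrix (x : (jetGroup n m hm).points) : Matrix (Fin (n + 2)) (Fin (n + 2)) ℂ :=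
  x.1.val

theorem jetGroupMatrix_mul (x y : (jetGroup n m hm).points) :
    jetGroupMatrix hm (x * y) = jetGroupMatrix hm x * jetGroupMatrix hm y := rfl

theorem jetGroupMatrix_inv (x : (jetGroup n m hm).points) :
    jetGroupMatrix hm x⁻¹ = (jetGroupMatrix hm x)⁻¹ :=
  Matrix.coe_units_inv (n := Fin (n + 2)) (x.1 : GL (Fin (n + 2)) ℂ)

theorem jetGroupMatrix_isJet (x : (jetGroup n m hm).points) : IsJet m (jetGroupMatrix hm x) :=
  x.2

/-- The subdiagonal filtration is a descending central series. The shift k + 1 makes step 0 the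
whole group, as m ≥ 1. -/
theorem jetGroup_nilpotent : (jetGroup n m hm).Nilpotent := by
  refine (Subgroup.nilpotent_iff_finite_descending_central_series _).2 ⟨n + 2, fun k =>
    { carrier := {x | (jetGroupMatrix hm x - 1).LowerBy (k + 1)}
      one_mem' := by
        change ((1 : Matrix (Fin (n + 2)) (Fin (n + 2)) ℂ) - 1).LowerBy (k + 1)
        rw [sub_self]
        exact fun _ _ _ => rfl
      mul_mem' := fun {a b} ha hb => by
        change (jetGroupMatrix hm (a * b) - 1).LowerBy (k + 1)
        rw [jetGroupMatrix_mul]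
        exact Matrix.LowerBy.mul_sub_one ha hb
      inv_mem' := fun {x} hx => by
        change (jetGroupMatrix hm x⁻¹ - 1).LowerBy (k + 1)
        rw [jetGroupMatrix_inv]
        exact Matrix.LowerBy.inv_sub_one hx (by omega) }, ⟨?_, ?_⟩, ?_⟩
  · exact eq_top_iff.2 fun x _ => (jetGroupMatrix_isJet hm x).1.mono (by omega)
  · intro x k hx g
    change (jetGroupMatrix hm (x * g * x⁻¹ * g⁻¹) - 1).LowerBy (k + 1 + 1)
    simp only [jetGroupMatrix_mul, jetGroupMatrix_inv]
    exact Matrix.LowerBy.commutator hx ((jetGroupMatrix_isJet hm g).1.mono hm) (by omega)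
  · refine eq_bot_iff.2 fun x hx => ?_
    have : jetGroupMatrix hm x - 1 = 0 := Matrix.LowerBy.eq_zero hx (by omega)
    exact Subtype.ext (Units.ext (sub_eq_zero.1 this))

end

/-! ### Parametrization by coefficients -/

section Parametrization

variable {R S : Type*} [CommRing R] [CommRing S] {n m d : ℕ}

/-- The matrix of `t ↦ t + ∑ v_l t ^ (m + 1 + l)`. -/
def jetOfCoeffs (n m : ℕ) (v : Fin d → R) : Matrix (Fin (n + 2)) (Fin (n + 2)) R :=
  jetMatrix n (Polynomial.X + ∑ l : Fin d, Polynomial.C (v l) * Polynomial.X ^ (m + 1 + (l : ℕ)))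

theorem isJet_jetOfCoeffs (v : Fin d → R) : IsJet m (jetOfCoeffs n m v) := by
  refine isJet_iff.2 ⟨_, ?_, rfl⟩
  rw [add_sub_cancel_left]
  exact Finset.dvd_sum fun l _ => (pow_dvd_pow _ (by omega)).mul_left _

theorem jetOfCoeffs_map (v : Fin d → R) (φ : R →+* S) :
    (jetOfCoeffs n m v).map φ = jetOfCoeffs n m fun l => φ (v l) := by
  rw [jetOfCoeffs, jetMatrix_map, jetOfCoeffs]
  simp [Polynomial.map_sum]

theorem jetOfCoeffs_apply_one (hm : 1 ≤ m) (hd : m + d = n + 1) (v : Fin d → R) (l : Fin d) :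
    jetOfCoeffs n m v ⟨m + 1 + l, by omega⟩ 1 = v l := by
  rw [jetOfCoeffs, jetMatrix_apply_one, Polynomial.coeff_add, Polynomial.coeff_X,
    if_neg (by dsimp only; omega), zero_add, Polynomial.finsetSum_coeff,
    Finset.sum_eq_single l]
  · simp
  · intro b _ hb
    rw [Polynomial.coeff_C_mul, Polynomial.coeff_X_pow, if_neg, mul_zero]
    intro h
    exact hb (Fin.ext (by dsimp only at h; omega))
  · simp

theorem IsJet.ext {M M' : Matrix (Fin (n + 2)) (Fin (n + 2)) R} (h : IsJet m M) (h' : IsJet m M')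
    (hcol : ∀ i, M i 1 = M' i 1) : M = M' := by
  refine h.2.trans (Eq.trans ?_ h'.2.symm)
  exact congrArg _ (Finset.sum_congr rfl fun k _ => by rw [hcol k])

theorem IsJet.eq_jetOfCoeffs (hd : m + d = n + 1) (hm : 1 ≤ m)
    {M : Matrix (Fin (n + 2)) (Fin (n + 2)) R} (h : IsJet m M) :
    M = jetOfCoeffs n m fun l : Fin d => M ⟨m + 1 + l, by omega⟩ 1 := by
  have h' := isJet_jetOfCoeffs (n := n) (m := m) fun l : Fin d => M ⟨m + 1 + l, by omega⟩ 1
  have hcol (i : Fin (n + 2)) :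
      M i 1 = jetOfCoeffs n m (fun l : Fin d => M ⟨m + 1 + l, by omega⟩ 1) i 1 := by
    rcases lt_or_ge (i : ℕ) (m + 1) with hi | hi
    · have hi' : (i : ℕ) < ((1 : Fin (n + 2)) : ℕ) + m := by simp; omega
      exact sub_left_injective ((h.1 i 1 hi').trans (h'.1 i 1 hi').symm)
    · obtain ⟨l, hl⟩ : ∃ l : Fin d, i = ⟨m + 1 + l, by omega⟩ :=
        ⟨⟨i - (m + 1), by omega⟩, Fin.ext (by dsimp only; omega)⟩
      rw [hl, jetOfCoeffs_apply_one hm hd]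
  exact h.ext h' hcol

/-- The coordinates of a matrix of determinant one. -/
def matrixCoord (M : Matrix (Fin n) (Fin n) R) : (Fin n × Fin n) ⊕ Unit → R :=
  Sum.elim (fun ij => M ij.1 ij.2) fun _ => 1

theorem map_matrixCoord (M : Matrix (Fin n) (Fin n) R) (φ : R →+* S)
    (i : (Fin n × Fin n) ⊕ Unit) : φ (matrixCoord M i) = matrixCoord (M.map φ) i := by
  cases i <;> simp [matrixCoord]

theorem IsJet.glCoord_eq (hm : 1 ≤ m) {g : GL (Fin (n + 2)) ℂ}
    (h : IsJet m (g : Matrix (Fin (n + 2)) (Fin (n + 2)) ℂ)) :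
    glCoord (n + 2) g = matrixCoord (g : Matrix (Fin (n + 2)) (Fin (n + 2)) ℂ) := by
  rw [glCoord, (h.1.mono hm).det_eq_one, inv_one]
  rfl

theorem IsJet.exists_gl (hm : 1 ≤ m) {M : Matrix (Fin (n + 2)) (Fin (n + 2)) ℂ} (h : IsJet m M) :
    ∃ g : GL (Fin (n + 2)) ℂ, (g : Matrix (Fin (n + 2)) (Fin (n + 2)) ℂ) = M :=
  ⟨Matrix.GeneralLinearGroup.mkOfDetNeZero M (by rw [(h.1.mono hm).det_eq_one]; exact one_ne_zero),
    rfl⟩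

end Parametrization

theorem MvPolynomial.surjective_of_X_mem_range {σ τ k : Type*} [CommRing k]
    (Φ : MvPolynomial σ k →ₐ[k] MvPolynomial τ k) (h : ∀ t, ∃ p, Φ p = X t) :
    Function.Surjective Φ := by
  rw [← AlgHom.range_eq_top, eq_top_iff, ← MvPolynomial.adjoin_range_X, Algebra.adjoin_le_iff]
  rintro _ ⟨t, rfl⟩
  exact h t

/-- Each parameter is itself an entry of column 1, which makes the parametrization a closed
embedding. -/
theorem exists_matrixCoord_jetOfCoeffs_eq {R : Type*} [CommRing R] {n m d : ℕ} (hm : 1 ≤ m)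
    (hd : m + d = n + 1) (l : Fin d) :
    ∃ i, ∀ v : Fin d → R, matrixCoord (jetOfCoeffs n m v) i = v l :=
  ⟨Sum.inl (⟨m + 1 + l, by omega⟩, 1), fun v => jetOfCoeffs_apply_one hm hd v l⟩

/-- The comorphism of the parametrization of the jet group by the coefficients. -/
def jetComorphism (n m d : ℕ) :
    MvPolynomial ((Fin (n + 2) × Fin (n + 2)) ⊕ Unit) ℂ →ₐ[ℂ] MvPolynomial (Fin d) ℂ :=
  aeval (matrixCoord (jetOfCoeffs n m X))

theorem jetComorphism_surjective {n m d : ℕ} (hm : 1 ≤ m) (hd : m + d = n + 1) :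
    Function.Surjective (jetComorphism n m d) :=
  MvPolynomial.surjective_of_X_mem_range _ fun l => by
    obtain ⟨i, hi⟩ := exists_matrixCoord_jetOfCoeffs_eq
      (R := MvPolynomial (Fin d) ℂ) hm hd l
    exact ⟨X i, by rw [jetComorphism, aeval_X, hi]⟩

theorem aeval_matrixCoord_jetOfCoeffs {τ : Type*} {n m d : ℕ} (u : τ → ℂ)
    (v : Fin d → MvPolynomial τ ℂ) (i : (Fin (n + 2) × Fin (n + 2)) ⊕ Unit) :
    aeval u (matrixCoord (jetOfCoeffs n m v) i) =
      matrixCoord (jetOfCoeffs n m fun l => aeval u (v l)) i := by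
  have := map_matrixCoord (jetOfCoeffs n m v) (aeval u : MvPolynomial τ ℂ →ₐ[ℂ] ℂ).toRingHom i
  rw [jetOfCoeffs_map] at this
  exact this

/-- Transfer to generic points: `φ` runs over evaluations at the points of a set and `ψ` is
evaluation at a point of its closure over a larger field. Polynomial identities pass from the former
to the latter. -/
theorem Matrix.map_eq_map_of_forall {N : ℕ} {ι R S T : Type*} [CommRing R] [CommRing S] [CommRing T]
    (φ : ι → R →+* S) (ψ : R →+* T) (h : ∀ r, (∀ y, φ y r = 0) → ψ r = 0)
    {A B : Matrix (Fin N) (Fin N) R} (hAB : ∀ y, A.map (φ y) = B.map (φ y)) :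
    A.map ψ = B.map ψ := by
  ext i j
  have := h (A i j - B i j) fun y => by
    rw [map_sub, sub_eq_zero]
    exact congrFun (congrFun (hAB y) i) j
  rwa [map_sub, sub_eq_zero] at this

theorem Matrix.map_sub_one {N : ℕ} {R S : Type*} [CommRing R] [CommRing S]
    (A : Matrix (Fin N) (Fin N) R) (φ : R →+* S) : (A - 1).map φ = A.map φ - 1 := by
  rw [Matrix.map_sub _ (map_sub φ), Matrix.map_one _ (map_zero φ) (map_one φ)]

theorem jetMatrix_sum_map {R S : Type*} [CommRing R] [CommRing S] {n : ℕ}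
    (M : Matrix (Fin (n + 2)) (Fin (n + 2)) R) (φ : R →+* S) :
    (jetMatrix n (∑ k : Fin (n + 2), Polynomial.C (M k 1) * Polynomial.X ^ (k : ℕ))).map φ =
      jetMatrix n (∑ k : Fin (n + 2), Polynomial.C (M.map φ k 1) * Polynomial.X ^ (k : ℕ)) := by
  rw [jetMatrix_map]
  simp [Polynomial.map_sum]

theorem IsJet.of_forall_map {n m : ℕ} {ι R S T : Type*} [CommRing R] [CommRing S] [CommRing T]
    (φ : ι → R →+* S) (ψ : R →+* T) (h : ∀ r, (∀ y, φ y r = 0) → ψ r = 0)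
    {M : Matrix (Fin (n + 2)) (Fin (n + 2)) R} (hM : ∀ y, IsJet m (M.map (φ y))) :
    IsJet m (M.map ψ) := by
  constructor
  · intro i j hij
    rw [← Matrix.map_sub_one]
    refine h _ fun y => ?_
    have := (hM y).1 i j hij
    rwa [← Matrix.map_sub_one] at this
  · rw [← jetMatrix_sum_map]
    refine Matrix.map_eq_map_of_forall φ ψ h fun y => ?_
    rw [jetMatrix_sum_map]
    exact (hM y).2

/-! ### Dimensions of the jet group and of its commuting pairs -/

section

variable {n m : ℕ}

theorem glCoord_image_jets {d : ℕ} (hm : 1 ≤ m) (hd : m + d = n + 1) :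
    glCoord (n + 2) '' {g | IsJet m (g : Matrix (Fin (n + 2)) (Fin (n + 2)) ℂ)} =
      Set.range fun (u : Fin d → ℂ) i => aeval u (jetComorphism n m d (X i)) := by
  simp only [jetComorphism, aeval_X, aeval_matrixCoord_jetOfCoeffs]
  ext x
  constructor
  · rintro ⟨g, hg, rfl⟩
    have hg : IsJet m (g : Matrix (Fin (n + 2)) (Fin (n + 2)) ℂ) := hg
    exact ⟨_, by rw [hg.glCoord_eq hm]; exact congrArg matrixCoord (hg.eq_jetOfCoeffs hd hm).symm⟩
  · rintro ⟨u, rfl⟩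
    have hu : IsJet m (jetOfCoeffs n m u) := isJet_jetOfCoeffs u
    obtain ⟨g, hg⟩ := hu.exists_gl hm
    rw [← hg] at hu
    exact ⟨g, hu, (hu.glCoord_eq hm).trans (congrArg matrixCoord hg)⟩

theorem jetGroup_dim {d : ℕ} (hm : 1 ≤ m) (hd : m + d = n + 1) : (jetGroup n m hm).dim = d := by
  have h := zariskiDim_range (jetComorphism n m d) (jetComorphism_surjective hm hd)
  rw [← glCoord_image_jets hm hd, Nat.card_fin] at h
  exact h

theorem jetGroup_connected {d : ℕ} (hm : 1 ≤ m) (hd : m + d = n + 1) : (jetGroup n m hm).Connected := by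
  refine isConnected_of_isPrime_vanishingIdeal (n := n + 2) _ ⟨1, one_mem _⟩ ?_
  change (vanishingIdeal ℂ (glCoord (n + 2) '' {g | IsJet m _})).IsPrime
  rw [glCoord_image_jets hm hd, vanishingIdeal_range]
  exact RingHom.ker_isPrime _

theorem glPairCoord_eq (hm : 1 ≤ m) {x : GL (Fin (n + 2)) ℂ × GL (Fin (n + 2)) ℂ}
    (h₁ : IsJet m (x.1 : Matrix (Fin (n + 2)) (Fin (n + 2)) ℂ))
    (h₂ : IsJet m (x.2 : Matrix (Fin (n + 2)) (Fin (n + 2)) ℂ)) :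
    glPairCoord (n + 2) x = Sum.elim
      (matrixCoord (x.1 : Matrix (Fin (n + 2)) (Fin (n + 2)) ℂ))
      (matrixCoord (x.2 : Matrix (Fin (n + 2)) (Fin (n + 2)) ℂ)) := by
  rw [glPairCoord, h₁.glCoord_eq hm, h₂.glCoord_eq hm]

/-- Being a jet and commuting are polynomial conditions, so a `K`-point of the closure is again a
commuting pair of jets, to which the count of generators applies. -/
theorem jetGroup_dimCommutingPairs_le (hm : 1 ≤ m) : (jetGroup n m hm).dimCommutingPairs ≤ n + 2 := by
  let P := {x : GL (Fin (n + 2)) ℂ × GL (Fin (n + 2)) ℂ // x.1 ∈ (jetGroup n m hm).points ∧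
    x.2 ∈ (jetGroup n m hm).points ∧ x.1 * x.2 = x.2 * x.1}
  have hP (y : P) : IsJet m (y.1.1 : Matrix (Fin (n + 2)) (Fin (n + 2)) ℂ) ∧
      IsJet m (y.1.2 : Matrix (Fin (n + 2)) (Fin (n + 2)) ℂ) := ⟨y.2.1, y.2.2.1⟩
  refine zariskiDim_le (glPairCoord (n + 2) '' (jetGroup n m hm).commutingPairs)
    ⟨_, 1, ⟨one_mem _, one_mem _, rfl⟩, rfl⟩ _ fun K _ _ x hx => ?_
  let A : Matrix (Fin (n + 2)) (Fin (n + 2)) (MvPolynomial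
      (((Fin (n + 2) × Fin (n + 2)) ⊕ Unit) ⊕ ((Fin (n + 2) × Fin (n + 2)) ⊕ Unit)) ℂ) :=
    Matrix.of fun i j => X (Sum.inl (Sum.inl (i, j)))
  let B : Matrix (Fin (n + 2)) (Fin (n + 2)) (MvPolynomial
      (((Fin (n + 2) × Fin (n + 2)) ⊕ Unit) ⊕ ((Fin (n + 2) × Fin (n + 2)) ⊕ Unit)) ℂ) :=
    Matrix.of fun i j => X (Sum.inr (Sum.inl (i, j)))
  let φ (y : P) := (aeval (glPairCoord (n + 2) y.1) :
    MvPolynomial (((Fin (n + 2) × Fin (n + 2)) ⊕ Unit) ⊕ ((Fin (n + 2) × Fin (n + 2)) ⊕ Unit)) ℂ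
      →ₐ[ℂ] ℂ).toRingHom
  let ψ := (aeval x :
    MvPolynomial (((Fin (n + 2) × Fin (n + 2)) ⊕ Unit) ⊕ ((Fin (n + 2) × Fin (n + 2)) ⊕ Unit)) ℂ
      →ₐ[ℂ] K).toRingHom
  have hψ (r) (hr : ∀ y, φ y r = 0) : ψ r = 0 := by
    refine hx r ?_
    rintro _ ⟨y, hy, rfl⟩
    exact hr ⟨y, hy⟩
  have hA (y : P) : A.map (φ y) = y.1.1.val := by
    ext i j
    simp [A, φ, glPairCoord, glCoord]
  have hB (y : P) : B.map (φ y) = y.1.2.val := by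
    ext i j
    simp [B, φ, glPairCoord, glCoord]
  have hAψ : IsJet m (A.map ψ) := IsJet.of_forall_map φ ψ hψ fun y => by
    rw [hA]; exact (hP y).1
  have hBψ : IsJet m (B.map ψ) := IsJet.of_forall_map φ ψ hψ fun y => by
    rw [hB]; exact (hP y).2
  have hcomm : A.map ψ * B.map ψ = B.map ψ * A.map ψ := by
    rw [← Matrix.map_mul, ← Matrix.map_mul]
    refine Matrix.map_eq_map_of_forall φ ψ hψ fun y => ?_
    rw [Matrix.map_mul, Matrix.map_mul, hA, hB]
    exact congrArg Units.val y.2.2.2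
  -- The inverse determinants are identically 1 on the set, hence also at `x`, and need no
  -- generator.
  have hdet (i : ((Fin (n + 2) × Fin (n + 2)) ⊕ Unit) ⊕ ((Fin (n + 2) × Fin (n + 2)) ⊕ Unit))
      (hi : ∀ y : P, glPairCoord (n + 2) y.1 i = 1) : x i = 1 := by
    have := hψ (X i - 1) fun y => by simp [φ, hi y]
    simpa [ψ, sub_eq_zero] using this
  obtain ⟨T, hT, hTA, hTB⟩ := exists_generators_of_commute hm hAψ hBψ hcomm
  refine ⟨T, hT, ?_⟩
  rintro ((⟨i, j⟩ | u) | (⟨i, j⟩ | u))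
  · simpa [A, ψ] using hTA i j
  · rw [hdet _ fun y => ?_]
    · exact one_mem _
    · rw [glPairCoord_eq hm (hP y).1 (hP y).2]; rfl
  · simpa [B, ψ] using hTB i j
  · rw [hdet _ fun y => ?_]
    · exact one_mem _
    · rw [glPairCoord_eq hm (hP y).1 (hP y).2]; rfl

end

/-- The comorphism of the parametrization of pairs of jets by their coefficients. -/
def jetPairComorphism (n m d : ℕ) :
    MvPolynomial (((Fin (n + 2) × Fin (n + 2)) ⊕ Unit) ⊕ ((Fin (n + 2) × Fin (n + 2)) ⊕ Unit)) ℂ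
      →ₐ[ℂ] MvPolynomial (Fin d ⊕ Fin d) ℂ :=
  aeval (Sum.elim (matrixCoord (jetOfCoeffs n m fun l => X (Sum.inl l)))
    (matrixCoord (jetOfCoeffs n m fun l => X (Sum.inr l))))

theorem jetPairComorphism_surjective {n m d : ℕ} (hm : 1 ≤ m) (hd : m + d = n + 1) :
    Function.Surjective (jetPairComorphism n m d) :=
  MvPolynomial.surjective_of_X_mem_range _ fun l => by
    rcases l with l | l <;>
    obtain ⟨i, hi⟩ := exists_matrixCoord_jetOfCoeffs_eq
      (R := MvPolynomial (Fin d ⊕ Fin d) ℂ) hm hd l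
    · exact ⟨X (Sum.inl i), by rw [jetPairComorphism, aeval_X, Sum.elim_inl, hi]⟩
    · exact ⟨X (Sum.inr i), by rw [jetPairComorphism, aeval_X, Sum.elim_inr, hi]⟩

/-- Since m ≤ h, the group contains all jets of depth `h`. These commute pairwise and have h + 1
free coefficients each. -/
theorem le_jetGroup_dimCommutingPairs {h m : ℕ} (hm : 1 ≤ m) (hmh : m ≤ h) :
    2 * h + 2 ≤ (jetGroup (2 * h) m hm).dimCommutingPairs := by
  have hd : h + (h + 1) = 2 * h + 1 := by omega
  have hh : 1 ≤ h := by omega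
  have key := le_zariskiDim
    (glPairCoord (2 * h + 2) '' (jetGroup (2 * h) m hm).commutingPairs)
    (jetPairComorphism (2 * h) h (h + 1)) (jetPairComorphism_surjective hh hd) fun u => by
      have hu₁ := isJet_jetOfCoeffs (n := 2 * h) (m := h) (u ∘ Sum.inl)
      have hu₂ := isJet_jetOfCoeffs (n := 2 * h) (m := h) (u ∘ Sum.inr)
      obtain ⟨g₁, hg₁⟩ := hu₁.exists_gl hh
      obtain ⟨g₂, hg₂⟩ := hu₂.exists_gl hh
      rw [← hg₁] at hu₁
      rw [← hg₂] at hu₂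
      refine ⟨(g₁, g₂), ⟨⟨hu₁.1.mono hmh, hu₁.2⟩, ⟨hu₂.1.mono hmh, hu₂.2⟩, Units.ext (hu₁.commute hh hu₂)⟩, ?_⟩
      rw [glPairCoord_eq hh hu₁ hu₂, hg₁, hg₂]
      funext i
      rcases i with i | i <;>
      simp [jetPairComorphism, aeval_matrixCoord_jetOfCoeffs, Function.comp_def]
  refine le_trans ?_ key
  simp
  omega

end

/-! ### Choice of the parameters -/

theorem mainTheorem5 (x : ℚ) (hx : 1 / 2 < x) (hx1 : x ≤ 1) :
    ∃ G : LinearAlgebraicGroup, G.Connected ∧ G.Nilpotent ∧ G.commutingProbability = x := by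
  obtain ⟨a, b, ha, hab, hxab⟩ : ∃ a b : ℕ, 1 ≤ a ∧ a ≤ b ∧ 2 * x - 1 = a / b := by
    have hpos : 0 < 2 * x - 1 := by linarith
    have hden := Rat.num_div_den (2 * x - 1)
    have hnum : 0 < (2 * x - 1).num := Rat.num_pos.2 hpos
    have hd0 : (0 : ℚ) < (2 * x - 1).den := by exact_mod_cast (2 * x - 1).den_pos
    refine ⟨(2 * x - 1).num.toNat, (2 * x - 1).den, by omega, ?_, ?_⟩
    · have h1 : ((2 * x - 1).num : ℚ) / (2 * x - 1).den ≤ 1 := by rw [hden]; linarith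
      rw [div_le_one hd0] at h1
      have : (2 * x - 1).num ≤ (2 * x - 1).den := by exact_mod_cast h1
      omega
    · have hnat : (((2 * x - 1).num.toNat : ℤ) : ℚ) = (2 * x - 1).num := by
        rw [Int.toNat_of_nonneg hnum.le]
      rw [← hnat, Int.cast_natCast] at hden
      exact hden.symm
  -- With h = a + b - 1, n = 2h and m = 2a - 1, the dimensions are n + 2 = 2(a + b) and n + 1 - m =
  -- 2b, so the quotient is (1 + a/b)/2 = x. The condition m ≤ h is a ≤ b, that is, x ≤ 1.
  have hm : 1 ≤ 2 * a - 1 := by omega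
  have hd : (2 * a - 1) + 2 * b = 2 * (a + b - 1) + 1 := by omega
  refine ⟨jetGroup (2 * (a + b - 1)) (2 * a - 1) hm, jetGroup_connected hm hd,
    jetGroup_nilpotent hm, ?_⟩
  have hdim : (jetGroup (2 * (a + b - 1)) (2 * a - 1) hm).dimCommutingPairs = 2 * (a + b) :=
    le_antisymm ((jetGroup_dimCommutingPairs_le hm).trans (by omega))
      (le_trans (by omega) (le_jetGroup_dimCommutingPairs hm (by omega)))
  rw [LinearAlgebraicGroup.commutingProbability, jetGroup_dim hm hd, hdim, if_neg (by omega)]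
  have hb : (b : ℚ) ≠ 0 := by
    have : b ≠ 0 := by omega
    exact_mod_cast this
  field_simp at hxab
  field_simp
  push_cast
  linarith
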